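/- Let $\pi$ be a finitely presented group, $n\ge 2$, $K(\pi,1)$ a connected CW complex with fundamental group $\pi$ and trivial higher homotopy groups, and $h\in H_n(\pi;\mathbb Z)=H_n(K(\pi,1);\mathbb Z)$. Let $(V,f,g)$ be a geometric cycle representing $h$: $V$ is an oriented $n$-dimensional pseudomanifold (a finite simplicial complex, purely $n$-dimensional, strongly connected, in which each $(n-1)$-simplex is a face of exactly two $n$-simplices), $f:V\to K(\pi,1)$ is continuous with $f_*[V]=h$, and $g$ is a piecewise smooth Riemannian metric on $V$. The relative systole $\mathrm{sys}(V,f,g)$ is the infimum of the lengths of the loops $c$ in $V$ such that $f\circ c$ is not contractible in $K(\pi,1)$. Assume that $g$ is scaled so that $\mathrm{sys}(V,f,g)=2$. Let $0<\varepsilon<\tfrac12$, let $V_0=\{v_1,\dots,v_N\}\subset V$ be finite, and let $r_\varepsilon:[0,1]\to[0,1]$ be the function equal to $0$ on $[0,\varepsilon]$, to $1$ on $[1-\varepsilon,1]$ and affine on $[\varepsilon,1-\varepsilon]$. Put $$J(v)=\bigl(r_\varepsilon(\min(\mathrm{dist}_g(v,v_i),1))\bigr)_{1\le i\le N}\in[0,1]^N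 ,$$ and let $K(V)=\bigcup_{v\in V}K(v)$, where $K(v)$ is the smallest face of $[0,1]^N$ containing $J(v)$. Assume that $J:V\to K(V)$ is an embedding; write $V'=J(V)$ and $f'=f\circ J^{-1}:V'\to K(\pi,1)$, and let $F:K(V)\to K(\pi,1)$ be a continuous extension of $f'$. Let $V''$ be an oriented $n$-dimensional pseudomanifold embedded in $K(V)$ and homologous to $V'$ in $K(V)$, that is, $[V'']=[V']$ in $H_n(K(V);\mathbb Z)$. Let $f''=F|_{V''}$. Then $(V'',f'')$ represents $h$, that is, $f''_*[V'']=h$. Suppose moreover that $(V,f,g)$ is normalized, i.e. $f_*:\pi_1(V)\to\pi$ is surjective, and that each closed simplex of $V''$ is $C^1$-embedded in $\mathbb R^N$ (differential injective up to the boundary). Let $g''$ be the hyper-Euclidean metric of $V''\subset(\mathbb R^N,\|\cdot\|_\infty)$: on each tangent space of each simplex, the Euclidean structure of least volume among those whose norm dominates $\|\cdot\|_\infty$ (lengths are those of piecewise $C^1$ paths, each piece being measured in any closed simplex that contains it). Then $$\mathrm{sys}(V'',f'',g'')\ \ge\ \mathrm{sys}(V,f,g).$$ -/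

import Mathlib

open CategoryTheory Set
open scoped ENNReal ContDiff

noncomputable section

namespace Systole

/-! ### Singular homology with integer coefficients -/

/-- The singular homology group `H_n(X; ℤ)`. -/
abbrev H (n : ℕ) (X : Type) [TopologicalSpace X] : ModuleCat.{0} ℤ :=
  ((AlgebraicTopology.singularHomologyFunctor (ModuleCat.{0} ℤ) n).obj
    (ModuleCat.of ℤ ℤ)).obj (TopCat.of X)

/-- The map `f_* : H_n(X; ℤ) → H_n(Y; ℤ)` induced by a continuous map. -/
def H.map (n : ℕ) {X Y : Type} [TopologicalSpace X] [TopologicalSpace Y] (f : C(X, Y)) :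
    H n X → H n Y :=
  ⇑(((AlgebraicTopology.singularHomologyFunctor (ModuleCat.{0} ℤ) n).obj
    (ModuleCat.of ℤ ℤ)).map (TopCat.ofHom f)).hom

/-- The singular chain complex of `X` with integer coefficients. -/
abbrev singularChains (X : Type) [TopologicalSpace X] : ChainComplex (ModuleCat.{0} ℤ) ℕ :=
  (TopCat.toSSet.obj (TopCat.of X)).chainComplex (ModuleCat.of ℤ ℤ)

/-- The `n`-chain consisting of one singular simplex, as a morphism `ℤ ⟶ C_n(X)`. -/
def singleChain {n : ℕ} {X : Type} [TopologicalSpace X]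
    (σ : C(stdSimplex ℝ (Fin (n + 1)), X)) :
    ModuleCat.of ℤ ℤ ⟶ (singularChains X).X n :=
  (TopCat.toSSet.obj (TopCat.of X)).ιChainComplex
    (((TopCat.of X).toSSetObjEquiv (Opposite.op (SimplexCategory.mk n))).symm σ)

theorem next_eq (n : ℕ) : (ComplexShape.down ℕ).next n = n - 1 := by
  cases n with
  | zero => simp
  | succ k => simp

/-- The homology class of a cycle `c`, the cycle being given as a morphism `ℤ ⟶ C_n(X)`. -/
def cycleClass {n : ℕ} {X : Type} [TopologicalSpace X]
    (c : ModuleCat.of ℤ ℤ ⟶ (singularChains X).X n)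
    (hc : c ≫ (singularChains X).d n (n - 1) = 0) : H n X :=
  ((singularChains X).liftCycles c (n - 1) (next_eq n) hc ≫
    (singularChains X).homologyπ n).hom (1 : ℤ)

/-! ### Eilenberg–MacLane spaces -/

/-- `X` is a `K(π, 1)`: a connected CW complex with fundamental group `π` and trivial higher
homotopy groups. -/
structure IsEilenbergMacLane (π : Type) [Group π] (X : Type) [TopologicalSpace X] : Prop where
  hausdorff : T2Space X
  cw : Nonempty (Topology.CWComplex (univ : Set X))
  connected : PathConnectedSpace X
  fundamentalGroup : ∀ x : X, Nonempty (FundamentalGroup X x ≃* π)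
  higher : ∀ (x : X) (i : ℕ), 2 ≤ i → Subsingleton (HomotopyGroup.Pi i X x)

/-- A continuous map is normal if it induces an epimorphism of fundamental groups. -/
def IsNormal {X Y : Type} [TopologicalSpace X] [TopologicalSpace Y] (f : C(X, Y)) : Prop :=
  ∀ x : X, Function.Surjective (FundamentalGroup.map f x)

/-! ### Pseudomanifolds -/

section Pseudomanifold

variable {E : Type} [NormedAddCommGroup E] [NormedSpace ℝ E]

/-- The simplices of dimension `n` of a simplicial complex. -/
abbrev NSimplex (K : Geometry.SimplicialComplex ℝ E) (n : ℕ) : Type :=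
  {s : Finset E // s ∈ K.faces ∧ s.card = n + 1}

/-- A finite simplicial complex of dimension `n` that is homogeneous, without branching, and
strongly connected. -/
structure IsPseudomanifold (K : Geometry.SimplicialComplex ℝ E) (n : ℕ) : Prop where
  finite : K.faces.Finite
  nonempty : Nonempty (NSimplex K n)
  homogeneous : ∀ s ∈ K.faces, ∃ t : NSimplex K n, s ⊆ t.1
  nonbranching : ∀ s ∈ K.faces, s.card = n → {t : NSimplex K n | s ⊆ t.1}.ncard = 2
  strongly_connected : ∀ s t : NSimplex K n, Relation.ReflTransGen
    (fun a b : NSimplex K n => ∃ r ∈ K.faces, r.card = n ∧ r ⊆ a.1 ∧ r ⊆ b.1) s t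

/-- The affine parametrization, by the standard simplex, of the simplex of `K` whose vertices are
`p 0, …, p n` in this order. -/
def affineSimplex (K : Geometry.SimplicialComplex ℝ E) {n : ℕ} (s : NSimplex K n)
    (p : Fin (n + 1) → E) (hp : range p = (s.1 : Set E)) :
    C(stdSimplex ℝ (Fin (n + 1)), K.space) where
  toFun x := ⟨∑ i, x.1 i • p i, by
    refine K.convexHull_subset_space s.2.1 ?_
    refine (convex_convexHull ℝ (s.1 : Set E)).sum_mem (fun i _ => x.2.1 i) x.2.2 fun i _ => ?_
    exact subset_convexHull ℝ _ (hp ▸ mem_range_self i)⟩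
  continuous_toFun := by
    refine Continuous.subtype_mk ?_ _
    refine continuous_finsetSum _ fun i _ => ?_
    exact ((continuous_apply i).comp continuous_subtype_val).smul continuous_const

variable (E) in
/-- A pseudomanifold of dimension `n` with an orientation: an ordering of the vertices and a sign
for each `n`-simplex, such that the signed sum of all the `n`-simplices is a singular cycle. -/
structure OrientedPseudomanifold (n : ℕ) where
  complex : Geometry.SimplicialComplex ℝ E
  isPseudomanifold : IsPseudomanifold complex n
  vertex : NSimplex complex n → Fin (n + 1) → E
  range_vertex : ∀ s, range (vertex s) = (s.1 : Set E)
  sign : NSimplex complex n → ℤˣ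
  isCycle : (∑ᶠ s : NSimplex complex n, (sign s : ℤ) •
      singleChain (affineSimplex complex s (vertex s) (range_vertex s))) ≫
    (singularChains complex.space).d n (n - 1) = 0

namespace OrientedPseudomanifold

variable {n : ℕ} (V : OrientedPseudomanifold E n)

/-- The underlying topological space. -/
abbrev space : Set E := V.complex.space

/-- The fundamental class `[V] ∈ H_n(V; ℤ)`. -/
def fundamentalClass : H n V.space := cycleClass _ V.isCycle

/-- `(V, f)` represents the homology class `h`, that is `f_*[V] = h`. -/
def Represents {X : Type} [TopologicalSpace X] (f : C(V.space, X)) (h : H n X) : Prop :=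
  H.map n f V.fundamentalClass = h

end OrientedPseudomanifold

end Pseudomanifold

/-! ### Lengths, distances and systoles on polyhedra -/

section Metric

variable {E : Type} [NormedAddCommGroup E] [NormedSpace ℝ E]

/-- A family of bilinear forms `g s x`, for `s` a simplex and `x` a point of `s`. Only the
restriction of `g s x` to the direction `vectorSpan ℝ s` of `s` is relevant. -/
abbrev FormFamily (E : Type) [NormedAddCommGroup E] [NormedSpace ℝ E] : Type :=
  Finset E → E → LinearMap.BilinForm ℝ E

/-- A piecewise smooth Riemannian metric on a polyhedron: a Riemannian metric on each closed
simplex, smooth in its interior, such that the metric of a simplex restricts to the metric of each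
of its faces. -/
structure IsRiemannian (K : Geometry.SimplicialComplex ℝ E) (g : FormFamily E) : Prop where
  symm : ∀ s ∈ K.faces, ∀ x ∈ convexHull ℝ (s : Set E),
    ∀ u ∈ vectorSpan ℝ (s : Set E), ∀ v ∈ vectorSpan ℝ (s : Set E), g s x u v = g s x v u
  pos : ∀ s ∈ K.faces, ∀ x ∈ convexHull ℝ (s : Set E),
    ∀ u ∈ vectorSpan ℝ (s : Set E), u ≠ 0 → 0 < g s x u u
  continuousOn : ∀ s ∈ K.faces,
    ∀ u ∈ vectorSpan ℝ (s : Set E), ∀ v ∈ vectorSpan ℝ (s : Set E),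
    ContinuousOn (fun x => g s x u v) (convexHull ℝ (s : Set E))
  smooth : ∀ s ∈ K.faces,
    ∀ u ∈ vectorSpan ℝ (s : Set E), ∀ v ∈ vectorSpan ℝ (s : Set E),
    ContDiffOn ℝ ∞ (fun x => g s x u v) (intrinsicInterior ℝ (convexHull ℝ (s : Set E)))
  compatible : ∀ s ∈ K.faces, ∀ t ∈ K.faces, s ⊆ t → ∀ x ∈ convexHull ℝ (s : Set E),
    ∀ u ∈ vectorSpan ℝ (s : Set E), ∀ v ∈ vectorSpan ℝ (s : Set E), g t x u v = g s x u v

/-- A subdivision of the path `γ` into finitely many `C¹` paths, each of them contained in one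
closed simplex. -/
structure Subdivision (K : Geometry.SimplicialComplex ℝ E) {x y : K.space} (γ : Path x y) where
  m : ℕ
  time : Fin (m + 1) → ℝ
  strictMono : StrictMono time
  time_zero : time 0 = 0
  time_last : time (Fin.last m) = 1
  simplex : Fin m → Finset E
  mem_faces : ∀ i, simplex i ∈ K.faces
  mapsTo : ∀ i : Fin m, MapsTo (fun t => (γ.extend t : E)) (Icc (time i.castSucc) (time i.succ))
    (convexHull ℝ (simplex i : Set E))
  contDiffOn : ∀ i : Fin m, ContDiffOn ℝ 1 (fun t => (γ.extend t : E))
    (Icc (time i.castSucc) (time i.succ))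

/-- The length of a piecewise `C¹` path with respect to `g`. -/
def Subdivision.length {K : Geometry.SimplicialComplex ℝ E} {x y : K.space} {γ : Path x y}
    (D : Subdivision K γ) (g : FormFamily E) : ℝ≥0∞ :=
  ∑ i, ∫⁻ t in Icc (D.time i.castSucc) (D.time i.succ),
    ENNReal.ofReal (Real.sqrt (g (D.simplex i) (γ.extend t : E)
      (derivWithin (fun r => (γ.extend r : E)) (Icc (D.time i.castSucc) (D.time i.succ)) t)
      (derivWithin (fun r => (γ.extend r : E)) (Icc (D.time i.castSucc) (D.time i.succ)) t)))

/-- The distance induced by `g`: the infimum of the lengths of the paths from `x` to `y`. -/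
def pathDist (K : Geometry.SimplicialComplex ℝ E) (g : FormFamily E) (x y : K.space) : ℝ≥0∞ :=
  ⨅ (γ : Path x y) (D : Subdivision K γ), D.length g

/-- The infimum of the lengths of the loops `c` at `v` such that `f ∘ c` is not contractible. -/
def systAt (K : Geometry.SimplicialComplex ℝ E) {X : Type} [TopologicalSpace X]
    (f : C(K.space, X)) (g : FormFamily E) (v : K.space) : ℝ≥0∞ :=
  ⨅ (γ : Path v v) (_ : ¬ (γ.map f.continuous).Homotopic (Path.refl (f v)))
    (D : Subdivision K γ), D.length g

/-- The relative systole. -/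
def syst (K : Geometry.SimplicialComplex ℝ E) {X : Type} [TopologicalSpace X]
    (f : C(K.space, X)) (g : FormFamily E) : ℝ≥0∞ :=
  ⨅ v : K.space, systAt K f g v

end Metric

/-- A geometric cycle `(V, f, g)` of dimension `n` with values in `X`. -/
structure GeometricCycle (d n : ℕ) (X : Type) [TopologicalSpace X] where
  V : OrientedPseudomanifold (EuclideanSpace ℝ (Fin d)) n
  f : C(V.space, X)
  g : FormFamily (EuclideanSpace ℝ (Fin d))
  isRiemannian : IsRiemannian V.complex g

/-! ### Faces of the cube -/

section Cube

variable {ι : Type}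

/-- The face of the cube `[0, 1]^ι` where the coordinates in `A` are `0` and those in `B` are
`1`. -/
def cubeFace (A B : Set ι) : Set (ι → ℝ) :=
  {φ | (∀ i, φ i ∈ Icc (0 : ℝ) 1) ∧ (∀ i ∈ A, φ i = 0) ∧ ∀ i ∈ B, φ i = 1}

/-- The smallest face of the cube that contains `x`. -/
def minFace (x : ι → ℝ) : Set (ι → ℝ) :=
  ⋂₀ {Φ | (∃ A B : Set ι, Φ = cubeFace A B) ∧ x ∈ Φ}

theorem self_mem_minFace (x : ι → ℝ) : x ∈ minFace x := fun _ h => h.2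

/-- For `x` in the cube, `minFace x` is indeed a face. -/
theorem minFace_eq {x : ι → ℝ} (hx : ∀ i, x i ∈ Icc (0 : ℝ) 1) :
    minFace x = cubeFace {i | x i = 0} {i | x i = 1} := by
  apply Subset.antisymm
  · exact sInter_subset_of_mem ⟨⟨_, _, rfl⟩, hx, fun _ h => h, fun _ h => h⟩
  · rintro φ ⟨h, h0, h1⟩ _ ⟨⟨A, B, rfl⟩, -, hA, hB⟩
    exact ⟨h, fun i hi => h0 i (hA i hi), fun i hi => h1 i (hB i hi)⟩

end Cube

/-! ### The extension of a geometric cycle -/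

/-- The piecewise affine function that is `0` on `[0, ε]`, `1` on `[1 - ε, 1]`, and affine on
`[ε, 1 - ε]`. -/
def r (ε t : ℝ) : ℝ := max 0 (min 1 ((t - ε) / (1 - 2 * ε)))

namespace GeometricCycle

variable {d n : ℕ} {X : Type} [TopologicalSpace X] (C : GeometricCycle d n X)

/-- The relative systole of `(V, f, g)`. -/
def syst : ℝ≥0∞ := Systole.syst C.V.complex C.f C.g

/-- The map `I₀ : V → ℝ^{V₀}` with coordinates `min (dist (v, w), 1)`, for `w ∈ V₀`. -/
def I₀ (V₀ : Finset C.V.space) (v : C.V.space) : V₀ → ℝ :=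
  fun w => (min (pathDist C.V.complex C.g v w) 1).toReal

/-- The union `K(V)` of the smallest faces `K(v)` of the cube `[0, 1]^{V₀}` that contain the points
`R_ε(I₀(v))`, for `v ∈ V`. -/
def extension (ε : ℝ) (V₀ : Finset C.V.space) : Set (V₀ → ℝ) :=
  ⋃ v, minFace fun w => r ε (C.I₀ V₀ v w)

/-- The map `J = R_ε ∘ I₀ : V → K(V)`. -/
def J (ε : ℝ) (V₀ : Finset C.V.space) (v : C.V.space) : C.extension ε V₀ :=
  ⟨fun w => r ε (C.I₀ V₀ v w), mem_iUnion.2 ⟨v, self_mem_minFace _⟩⟩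

end GeometricCycle

/-! ### The hyper-Euclidean metric of a pseudomanifold embedded in `(ℝ^N, ‖ ‖_∞)` -/

section HyperEuclidean

variable {E : Type} [NormedAddCommGroup E] [NormedSpace ℝ E]

/-- `B` is symmetric on `T` and its quadratic form dominates the square of the function `N`. -/
def Dominates (T : Submodule ℝ E) (N : E → ℝ) (B : LinearMap.BilinForm ℝ E) : Prop :=
  (∀ u ∈ T, ∀ v ∈ T, B u v = B v u) ∧ ∀ u ∈ T, N u ^ 2 ≤ B u u

/-- Among the Euclidean structures on `T` whose norm dominates `N`, the structure `B` is one whose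
volume is minimal. Volumes are compared by the Gram determinant in a basis. -/
def IsHyperEuclidean (T : Submodule ℝ E) (N : E → ℝ) (B : LinearMap.BilinForm ℝ E) : Prop :=
  Dominates T N B ∧ ∀ B' : LinearMap.BilinForm ℝ E, Dominates T N B' →
    ∀ (m : ℕ) (b : Module.Basis (Fin m) ℝ T),
      (Matrix.of fun i k => B (b i) (b k)).det ≤ (Matrix.of fun i k => B' (b i) (b k)).det

variable {n : ℕ} (W : OrientedPseudomanifold E n) {ι : Type} [Fintype ι] {Y : Set (ι → ℝ)}
  (j : C(W.space, Y))

/-- The map `j`, as a map from the ambient space of `W` (with value `0` outside `W`) to `ℝ^ι`. -/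
def ambient : E → ι → ℝ :=
  Function.extend Subtype.val (fun x : W.space => ((j x : Y) : ι → ℝ)) 0

/-- On each closed simplex, `j` is of class `C¹` and its differential is injective. -/
def IsPiecewiseImmersion : Prop :=
  ∀ s ∈ W.complex.faces,
    ContDiffOn ℝ 1 (ambient W j) (convexHull ℝ (s : Set E)) ∧
    ∀ x ∈ convexHull ℝ (s : Set E), ∀ u ∈ vectorSpan ℝ (s : Set E),
      fderivWithin ℝ (ambient W j) (convexHull ℝ (s : Set E)) x u = 0 → u = 0

/-- `g` is, through `j`, the hyper-Euclidean metric of the image of `W` in `(ℝ^ι, ‖ ‖_∞)`: on each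
tangent space of each simplex, it is the Euclidean structure of minimal volume whose norm dominates
`‖ ‖_∞`. (The norm of `ι → ℝ` is the sup norm.) -/
def IsHyperEuclideanMetric (g : FormFamily E) : Prop :=
  ∀ s ∈ W.complex.faces, ∀ x ∈ convexHull ℝ (s : Set E),
    IsHyperEuclidean (vectorSpan ℝ (s : Set E))
      (fun u => ‖fderivWithin ℝ (ambient W j) (convexHull ℝ (s : Set E)) x u‖) (g s x)

end HyperEuclidean

end Systole

end

/-!
The statement about homology classes is functoriality: `F ∘ j` and `C.f = F ∘ J` send the two
homologous classes in `K(V)` to the same class in `X`.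

For the systole, the point is that a loop in `K(V)` of sup-norm length less than `2` is already
contractible in `K(V)`. It has to come back to its starting point, so any two of its points are at
distance less than `1` (`two_mul_edist_le_eVariationOn`), and no coordinate takes both values `0`
and `1` on it. Let `e` be the vertex of the cube whose `i`-th coordinate is `0` if the `i`-th
coordinate vanishes somewhere on the loop, and `1` otherwise. Since `K(V)` is a union of faces of
the cube, it contains the segments that join `e` to the points of the loop, and the union of these
segments is contractible (`homotopic_refl_of_cube`).

As the norm of the hyper-Euclidean metric dominates the sup norm, the image in `K(V)` of a loop of
`W` of hyper-Euclidean length less than `2` has sup-norm length less than `2`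
(`eVariationOn_le_length`), so `F ∘ j` sends the loop to a contractible one. Hence the relative
systole of `W` is at least `2 = C.syst`.
-/

namespace Systole

/-! ### Variation of curves -/

theorem eVariationOn_le_lintegral_derivWithin {F : Type*} [NormedAddCommGroup F]
    [NormedSpace ℝ F] {f : ℝ → F} {a b : ℝ} (hf : ContDiffOn ℝ 1 f (Icc a b)) :
    eVariationOn f (Icc a b) ≤ ∫⁻ t in Icc a b, ‖derivWithin f (Icc a b) t‖ₑ := by
  have hderiv : ∫⁻ t in Icc a b, ‖derivWithin f (Icc a b) t‖ₑ = ∫⁻ t in Icc a b, ‖deriv f t‖ₑ := by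
    apply MeasureTheory.lintegral_congr_ae
    rw [← MeasureTheory.restrict_Ioo_eq_restrict_Icc]
    filter_upwards [MeasureTheory.self_mem_ae_restrict measurableSet_Ioo] with x hx
    rw [derivWithin_of_mem_nhds (Icc_mem_nhds hx.1 hx.2)]
  rw [hderiv]
  refine iSup_le fun ⟨n, u, hu, hus⟩ => ?_
  have hsum : ∀ m, ∑ i ∈ Finset.range m, edist (f (u (i + 1))) (f (u i)) ≤
      ∫⁻ t in Ioc (u 0) (u m), ‖deriv f t‖ₑ := by
    intro m
    induction m with
    | zero => simp
    | succ m ih =>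
      rw [Finset.sum_range_succ, ← Ioc_union_Ioc_eq_Ioc (hu m.zero_le) (hu m.le_succ),
        MeasureTheory.lintegral_union measurableSet_Ioc (Ioc_disjoint_Ioc_of_le le_rfl)]
      refine add_le_add ih ?_
      rw [edist_eq_enorm_sub, MeasureTheory.restrict_Ioc_eq_restrict_Icc]
      exact enorm_sub_le_lintegral_deriv_of_contDiffOn_Icc
        (hf.mono (Icc_subset_Icc (hus m).1 (hus (m + 1)).2)) (hu m.le_succ)
  exact (hsum n).trans (MeasureTheory.lintegral_mono_set
    (Ioc_subset_Icc_self.trans (Icc_subset_Icc (hus 0).1 (hus n).2)))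

/-- A closed curve runs at least twice the distance of any two of its points: it has to come
back. -/
theorem two_mul_edist_le_eVariationOn {F : Type*} [PseudoEMetricSpace F] {f : ℝ → F} {a b : ℝ}
    (hf : f a = f b) {s t : ℝ} (hs : s ∈ Icc a b) (ht : t ∈ Icc a b) :
    2 * edist (f s) (f t) ≤ eVariationOn f (Icc a b) := by
  wlog hst : s ≤ t generalizing s t
  · rw [edist_comm]
    exact this ht hs (le_of_not_ge hst)
  have h₁ := eVariationOn.Icc_add_Icc f (s := univ) hs.1 hst (mem_univ s)
  have h₂ := eVariationOn.Icc_add_Icc f (s := univ) ht.1 ht.2 (mem_univ t)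
  simp only [univ_inter] at h₁ h₂
  rw [← h₂, ← h₁]
  have e₁ := eVariationOn.edist_le f (left_mem_Icc.2 hs.1) (right_mem_Icc.2 hs.1)
  have e₂ := eVariationOn.edist_le f (left_mem_Icc.2 hst) (right_mem_Icc.2 hst)
  have e₃ := eVariationOn.edist_le f (left_mem_Icc.2 ht.2) (right_mem_Icc.2 ht.2)
  calc 2 * edist (f s) (f t) = edist (f s) (f t) + edist (f s) (f t) := two_mul _
    _ ≤ (edist (f a) (f s) + edist (f t) (f b)) + edist (f s) (f t) := by
      gcongr
      rw [← hf, edist_comm (f a), add_comm, edist_comm (f t)]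
      exact (edist_triangle_right _ _ (f a)).trans_eq (by
        rw [add_comm, edist_comm (f t)])
    _ = edist (f a) (f s) + edist (f s) (f t) + edist (f t) (f b) := by ring
    _ ≤ _ := by gcongr

theorem derivWithin_mem_vectorSpan {E : Type*} [NormedAddCommGroup E] [NormedSpace ℝ E]
    (s : Finset E) {f : ℝ → E} {a b : ℝ} (hab : a ≤ b)
    (hf : MapsTo f (Icc a b) (convexHull ℝ (s : Set E))) (t : ℝ) :
    derivWithin f (Icc a b) t ∈ vectorSpan ℝ (s : Set E) := by
  have : FiniteDimensional ℝ (vectorSpan ℝ (s : Set E)) :=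
    finiteDimensional_vectorSpan_of_finite ℝ s.finite_toSet
  have h := range_derivWithin_subset_closure_span_image (fun r => f r - f a)
    (s := Icc a b) (t := Icc a b) (by simp)
  have ht := h (mem_range_self t)
  rw [derivWithin_sub_const] at ht
  refine closure_minimal ?_ (Submodule.closed_of_finiteDimensional _) ht
  refine Submodule.span_le.2 ?_
  rintro _ ⟨r, hr, rfl⟩
  rw [← direction_affineSpan, ← affineSpan_convexHull, direction_affineSpan]
  exact vsub_mem_vectorSpan ℝ (hf hr) (hf (left_mem_Icc.2 hab))

/-! ### Hyper-Euclidean length and sup-norm length -/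

section HyperEuclidean

variable {E : Type} [NormedAddCommGroup E] [NormedSpace ℝ E] {n : ℕ}
  {W : OrientedPseudomanifold E n} {ι : Type} {Y : Set (ι → ℝ)} {j : C(W.space, Y)}

theorem ambient_apply (x : W.space) : ambient W j x = (j x : ι → ℝ) :=
  Subtype.val_injective.extend_apply _ _ x

/-- The bound of `eVariationOn_le_length` for a `C¹` path in one closed simplex. -/
theorem eVariationOn_le_lintegral_of_isHyperEuclideanMetric [Fintype ι]
    (hI : IsPiecewiseImmersion W j) {g : FormFamily E} (hg : IsHyperEuclideanMetric W j g)
    {s : Finset E} (hs : s ∈ W.complex.faces) {c : ℝ → W.space} {a b : ℝ} (hab : a ≤ b)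
    (hc : MapsTo (fun t => (c t : E)) (Icc a b) (convexHull ℝ (s : Set E)))
    (hc₁ : ContDiffOn ℝ 1 (fun t => (c t : E)) (Icc a b)) :
    eVariationOn (fun t => (j (c t) : ι → ℝ)) (Icc a b) ≤
      ∫⁻ t in Icc a b, ENNReal.ofReal (Real.sqrt (g s (c t)
        (derivWithin (fun r => (c r : E)) (Icc a b) t)
        (derivWithin (fun r => (c r : E)) (Icc a b) t))) := by
  rcases hab.eq_or_lt with rfl | hab'
  · simp [eVariationOn.subsingleton]
  have hj : (fun t => (j (c t) : ι → ℝ)) = ambient W j ∘ fun t => (c t : E) :=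
    funext fun t => (ambient_apply _).symm
  rw [hj]
  have hcomp := (hI s hs).1.comp hc₁ hc
  refine (eVariationOn_le_lintegral_derivWithin hcomp).trans
    (MeasureTheory.setLIntegral_mono_ae' measurableSet_Icc (.of_forall fun t ht => ?_))
  -- The simplex need not have unique derivatives in `E`, but the chain rule holds for every
  -- derivative within it.
  have hd := (((hI s hs).1.differentiableOn one_ne_zero _ (hc ht)).hasFDerivWithinAt
    |>.comp_hasDerivWithinAt t (hc₁.differentiableOn one_ne_zero t ht).hasDerivWithinAt hc)
  rw [hd.derivWithin (uniqueDiffOn_Icc hab' t ht), ← ofReal_norm]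
  refine ENNReal.ofReal_le_ofReal (Real.le_sqrt_of_sq_le ?_)
  exact (hg s hs _ (hc ht)).1.2 _ (derivWithin_mem_vectorSpan s hab hc t)

/-- The hyper-Euclidean metric dominates the sup norm, so the image in `(ℝ^ι, ‖ ‖_∞)` of a path
is at most as long as the path. -/
theorem eVariationOn_le_length [Fintype ι] (hI : IsPiecewiseImmersion W j) {g : FormFamily E}
    (hg : IsHyperEuclideanMetric W j g) {x y : W.space} {γ : Path x y}
    (D : Subdivision W.complex γ) :
    eVariationOn (fun t => (j (γ.extend t) : ι → ℝ)) (Icc 0 1) ≤ D.length g := by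
  -- The subdivision times, as a monotone sequence that is constant from the index `D.m` on.
  let I : ℕ → ℝ := fun k => D.time ⟨min k D.m, by omega⟩
  have hI_mono : Monotone I := fun k l hkl =>
    D.strictMono.monotone (Fin.mk_le_mk.2 (min_le_min_right _ hkl))
  have h0 : I 0 = 0 := by simpa [I] using D.time_zero
  have h1 : I D.m = 1 := by
    rw [← D.time_last]; simp only [I, min_self]; rfl
  rw [← h0, ← h1, ← eVariationOn.sum' _ hI_mono, Finset.sum_range, Subdivision.length]
  refine Finset.sum_le_sum fun i _ => ?_
  have ha : I i = D.time i.castSucc := congrArg D.time (Fin.ext (min_eq_left i.2.le))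
  have hb : I (i + 1) = D.time i.succ := congrArg D.time (Fin.ext (min_eq_left i.2))
  rw [ha, hb]
  have hab : D.time i.castSucc < D.time i.succ := D.strictMono i.castSucc_lt_succ
  exact eVariationOn_le_lintegral_of_isHyperEuclideanMetric hI hg (D.mem_faces i) hab.le
    (D.mapsTo i) (D.contDiffOn i)

end HyperEuclidean

/-! ### Short loops in cubical complexes -/

/-- A face of the cube that contains `x` contains the segment from `x` to `e`, as soon as `e` has
the same `i`-th coordinate as `x` whenever that of `x` is `0` or `1`. -/
theorem segment_subset_cubeFace {ι : Type} {x e : ι → ℝ} {A B : Set ι} (hx : x ∈ cubeFace A B)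
    (he : ∀ i, e i ∈ Icc (0 : ℝ) 1) (h0 : ∀ i, x i = 0 → e i = 0) (h1 : ∀ i, x i = 1 → e i = 1) :
    segment ℝ e x ⊆ cubeFace A B := by
  rintro _ ⟨a, b, ha, hb, hab, rfl⟩
  refine ⟨fun i => convex_Icc 0 1 (he i) (hx.1 i) ha hb hab, fun i hi => ?_, fun i hi => ?_⟩
  · simp [hx.2.1 i hi, h0 i (hx.2.1 i hi)]
  · simp [hx.2.2 i hi, h1 i (hx.2.2 i hi), hab]

/-- In a union of faces of the cube, a loop on which no coordinate takes both values `0` and `1`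
is contractible: it lies in the union of the segments joining its points to one vertex. -/
theorem homotopic_refl_of_cube {ι : Type} {Y : Set (ι → ℝ)}
    (hY : ∀ x ∈ Y, ∃ A B : Set ι, x ∈ cubeFace A B ∧ cubeFace A B ⊆ Y) {y : Y} (γ : Path y y)
    (hγ : ∀ i s t, (γ s : ι → ℝ) i = 0 → (γ t : ι → ℝ) i ≠ 1) :
    γ.Homotopic (Path.refl y) := by
  classical
  let e : ι → ℝ := fun i => if ∃ t, (γ t : ι → ℝ) i = 0 then 0 else 1
  have he : ∀ i, e i ∈ Icc (0 : ℝ) 1 := fun i => by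
    simp only [e]; split_ifs <;> simp
  let S : Set (ι → ℝ) := ⋃ t, segment ℝ e (γ t : ι → ℝ)
  have hSY : S ⊆ Y := by
    refine iUnion_subset fun t => ?_
    obtain ⟨A, B, hx, hAB⟩ := hY _ (γ t).2
    refine (segment_subset_cubeFace hx he (fun i hi => if_pos ⟨t, hi⟩) fun i hi => ?_).trans hAB
    exact if_neg fun ⟨s, hs⟩ => hγ i s t hs hi
  have hS : StarConvex ℝ e S := starConvex_iUnion fun t =>
    (convex_segment e _).starConvex (left_mem_segment ℝ _ _)
  have hγS : ∀ t, (γ t : ι → ℝ) ∈ S := fun t => mem_iUnion.2 ⟨t, right_mem_segment ℝ _ _⟩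
  have hyS : (y : ι → ℝ) ∈ S := by simpa using hγS 0
  have := hS.contractibleSpace ⟨_, hyS⟩
  let δ : Path (⟨y, hyS⟩ : S) ⟨y, hyS⟩ :=
    { toFun := fun t => ⟨γ t, hγS t⟩
      continuous_toFun := by fun_prop
      source' := by simp
      target' := by simp }
  exact (SimplyConnectedSpace.paths_homotopic δ (Path.refl _)).map
    (⟨inclusion hSY, continuous_inclusion hSY⟩ : C(S, Y))

theorem r_mem_Icc (ε t : ℝ) : r ε t ∈ Icc (0 : ℝ) 1 :=
  ⟨le_max_left _ _, max_le zero_le_one (min_le_left _ _)⟩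

/-- `K(V)` is a union of faces of the cube. -/
theorem GeometricCycle.exists_cubeFace_subset_extension {d n : ℕ} {X : Type} [TopologicalSpace X]
    (C : GeometricCycle d n X) (ε : ℝ) (V₀ : Finset C.V.space) :
    ∀ x ∈ C.extension ε V₀, ∃ A B : Set V₀, x ∈ cubeFace A B ∧
      cubeFace A B ⊆ C.extension ε V₀ := by
  intro x hx
  obtain ⟨v, hv⟩ := mem_iUnion.1 hx
  have h := minFace_eq (x := fun w => r ε (C.I₀ V₀ v w)) fun w => r_mem_Icc _ _
  exact ⟨_, _, h ▸ hv, h ▸ subset_iUnion (fun v => minFace fun w => r ε (C.I₀ V₀ v w)) v⟩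

theorem H.map_comp {n : ℕ} {X Y Z : Type} [TopologicalSpace X] [TopologicalSpace Y]
    [TopologicalSpace Z] (g : C(Y, Z)) (f : C(X, Y)) (a : H n X) :
    H.map n (g.comp f) a = H.map n g (H.map n f a) := by
  simp only [H.map, TopCat.ofHom_comp, Functor.map_comp, ModuleCat.hom_comp, LinearMap.comp_apply]

end Systole

theorem mainTheorem6 {π : Type} [Group π] [Group.IsFinitelyPresented π]
    {X : Type} [TopologicalSpace X] (hX : Systole.IsEilenbergMacLane π X)
    {n : ℕ} (hn : 2 ≤ n) (h : Systole.H n X)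
    {d : ℕ} (C : Systole.GeometricCycle d n X) (hC : C.V.Represents C.f h) (hsyst : C.syst = 2)
    {ε : ℝ} (hε : 0 < ε) (hε' : ε < 1 / 2) (V₀ : Finset C.V.space)
    (hJ : Topology.IsEmbedding (C.J ε V₀))
    (F : C(C.extension ε V₀, X)) (hF : ∀ v, F (C.J ε V₀ v) = C.f v)
    {d' : ℕ} (W : Systole.OrientedPseudomanifold (EuclideanSpace ℝ (Fin d')) n)
    (j : C(W.space, C.extension ε V₀)) (hj : Topology.IsEmbedding j)
    (hW : Systole.H.map n j W.fundamentalClass =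
      Systole.H.map n ⟨C.J ε V₀, hJ.continuous⟩ C.V.fundamentalClass) :
    W.Represents (F.comp j) h ∧
    (Systole.IsNormal C.f → Systole.IsPiecewiseImmersion W j →
      ∀ g : Systole.FormFamily (EuclideanSpace ℝ (Fin d')),
        Systole.IsHyperEuclideanMetric W j g →
        C.syst ≤ Systole.syst W.complex (F.comp j) g) := by
  refine ⟨?_, fun _ hI g hg => le_iInf fun v => le_iInf fun γ => le_iInf fun hγ =>
    le_iInf fun D => ?_⟩
  · rw [Systole.OrientedPseudomanifold.Represents, Systole.H.map_comp, hW, ← Systole.H.map_comp]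
    have hFJ : F.comp ⟨C.J ε V₀, hJ.continuous⟩ = C.f := ContinuousMap.ext hF
    rw [hFJ]
    exact hC
  · rw [hsyst]
    contrapose! hγ
    have hcontr : (γ.map j.continuous).Homotopic (Path.refl (j v)) := by
      refine Systole.homotopic_refl_of_cube (C.exists_cubeFace_subset_extension ε V₀) _
        fun i s t h0 h1 => hγ.not_ge ?_
      -- A coordinate equal to `0` at `s` and to `1` at `t` makes the loop of length at least `2`.
      refine le_trans ?_ (Systole.eVariationOn_le_length hI hg D)
      refine le_trans ?_ (Systole.two_mul_edist_le_eVariationOn (by simp) s.2 t.2)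
      refine (mul_one (2 : ENNReal)).symm.le.trans (mul_le_mul_right ?_ 2)
      refine le_trans ?_ (edist_le_pi_edist _ _ i)
      simp only [Path.map_coe, Function.comp_apply] at h0 h1
      simp [h0, h1, edist_dist]
    exact hcontr.map F
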